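/- **Theorem 5.2.** Let $\mathcal H$ be a complex Hilbert space with inner product $\langle\cdot,\cdot\rangle$ (for instance $L^2[(a,b),w]$). All powers of unbounded operators are taken on their natural domains, $\mathcal D(A^n)=\{f : f,Af,\dots,A^{n-1}f\in\mathcal D(A)\}$. Let $L_{\min}$ be a densely defined, closed, symmetric operator in $\mathcal H$ with finite deficiency indices $(m,m)$, i.e. $\dim\ker(L_{\min}^*-i)=\dim\ker(L_{\min}^*+i)=m$, and put $L_{\max}:=L_{\min}^*$ (for instance, the minimal and the maximal operator of a Sturm–Liouville expression $\ell$). Let $L$ be a self-adjoint extension of $L_{\min}$ that is bounded below, and suppose that $L$ has eigenfunctions $P_k\in\mathcal D(L)$, $k=0,1,2,\dots$, which are nonzero, pairwise orthogonal and complete in $\mathcal H$ (their linear span is dense). Let $n\ge 1$ be an integer. Then: 1. $L_{\min}^n$ is densely defined, closed and symmetric, $(L_{\min}^n)^*=L_{\max}^n$, and $L^n$ is a self-adjoint extension of $L_{\min}^n$. 2. $L_{\min}^n$ has deficiency indices $(nm,nm)$. 3. For all real $c$ and all $k>0$ such that $\langle (L+c)x,x\rangle\ge k\langle x,x\rangle$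 for every $x\in\mathcal D(L)$, the underlying vector space $\mathcal D((L+c)^n)$ of the $2n$-th left-definite space associated with $L+c$ is $\mathcal D(L^n)$. 4. There are $nm$ distinct indices $k_1,\dots,k_{nm}$ such that $P_{k_1},\dots,P_{k_{nm}}$ are GKN conditions for this space. That is, with $[f,g]_n:=\langle L_{\max}^nf,g\rangle-\langle f,L_{\max}^ng\rangle$ for $f,g\in\mathcal D(L_{\max}^n)$: the functions $P_{k_1},\dots,P_{k_{nm}}$ belong to $\mathcal D(L_{\max}^n)$, they are linearly independent modulo $\mathcal D(L_{\min}^n)$, they satisfy $[P_{k_i},P_{k_j}]_n=0$ for all $i,j$, and $$\mathcal D(L^n)=\{f\in\mathcal D(L_{\max}^n) : [f,P_{k_i}]_n=0\text{ for } i=1,\dots,nm\}.$$ -/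

import Mathlib

namespace LeftDefinite

noncomputable section

variable {H : Type*} [NormedAddCommGroup H] [InnerProductSpace ℂ H]

/-- Composition `A ∘ B` of unbounded operators on its natural domain
`{x ∈ D(B) | B x ∈ D(A)}`. -/
def opComp (A B : H →ₗ.[ℂ] H) : H →ₗ.[ℂ] H where
  domain :=
    { carrier := {x | ∃ h : x ∈ B.domain, B ⟨x, h⟩ ∈ A.domain}
      zero_mem' := ⟨B.domain.zero_mem, by
        have h0 : B ⟨0, B.domain.zero_mem⟩ = 0 := B.map_zero
        rw [h0]; exact A.domain.zero_mem⟩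
      add_mem' := by
        rintro x y ⟨hx, hx'⟩ ⟨hy, hy'⟩
        refine ⟨B.domain.add_mem hx hy, ?_⟩
        have h0 : B ⟨x + y, B.domain.add_mem hx hy⟩ = B ⟨x, hx⟩ + B ⟨y, hy⟩ :=
          B.map_add ⟨x, hx⟩ ⟨y, hy⟩
        rw [h0]; exact A.domain.add_mem hx' hy'
      smul_mem' := by
        rintro c x ⟨hx, hx'⟩
        refine ⟨B.domain.smul_mem c hx, ?_⟩
        have h0 : B ⟨c • x, B.domain.smul_mem c hx⟩ = c • B ⟨x, hx⟩ :=
          B.map_smul c ⟨x, hx⟩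
        rw [h0]; exact A.domain.smul_mem c hx' }
  toFun :=
    { toFun := fun x => A ⟨B ⟨x.1, x.2.choose⟩, x.2.choose_spec⟩
      map_add' := fun x y => by
        rw [← A.map_add]
        congr 1
        exact Subtype.ext (B.map_add ⟨x.1, x.2.choose⟩ ⟨y.1, y.2.choose⟩)
      map_smul' := fun c x => by
        rw [RingHom.id_apply, ← A.map_smul]
        congr 1
        exact Subtype.ext (B.map_smul c ⟨x.1, x.2.choose⟩) }

/-- The power `A ^ n` of an unbounded operator, by repeated composition on natural domains:
`D(A ^ n) = {x | x, A x, …, A ^ (n - 1) x ∈ D(A)}`, and `A ^ 0` is the identity of `H`. -/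
def opPow (A : H →ₗ.[ℂ] H) : ℕ → (H →ₗ.[ℂ] H)
  | 0 => LinearMap.id.toPMap ⊤
  | n + 1 => opComp A (opPow A n)

/-- The shifted operator `A + c I`, on the domain of `A`. -/
def opShift (A : H →ₗ.[ℂ] H) (c : ℝ) : H →ₗ.[ℂ] H :=
  ((c : ℂ) • (LinearMap.id : H →ₗ[ℂ] H)) +ᵥ A

/-- `A` is bounded below by `k`: `⟨A x, x⟩ ≥ k ⟨x, x⟩` for all `x ∈ D(A)`. -/
def IsBoundedBelowBy (A : H →ₗ.[ℂ] H) (k : ℝ) : Prop :=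
  ∀ x : A.domain, k * ‖(x : H)‖ ^ 2 ≤ RCLike.re (inner ℂ (x : H) (A x))

/-- `A` is a densely defined, symmetric and closed operator. -/
structure IsClosedSymmetric (A : H →ₗ.[ℂ] H) : Prop where
  dense : Dense (A.domain : Set H)
  symmetric : ∀ x y : A.domain, inner ℂ (A x) (y : H) = inner ℂ (x : H) (A y)
  closed : A.IsClosed

/-- `P 0, P 1, …` is a complete orthogonal system of eigenfunctions of `A`: nonzero, pairwise
orthogonal eigenvectors lying in `D(A)`, with dense linear span in `H`. -/
structure IsCompleteOrthogonalEigensystem (A : H →ₗ.[ℂ] H) (P : ℕ → H) : Prop where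
  ne_zero : ∀ k, P k ≠ 0
  eigen : ∀ k, ∃ (h : P k ∈ A.domain) (μ : ℂ), A ⟨P k, h⟩ = μ • P k
  orthogonal : ∀ j k, j ≠ k → inner ℂ (P j) (P k) = 0
  complete : Dense (Submodule.span ℂ (Set.range P) : Set H)

/-- The underlying vector space `V_{2n} = D(A ^ (2n / 2)) = D(A ^ n)` of the `2n`-th left-definite
space associated with a self-adjoint operator `A` that is bounded below by some `k > 0`
(its inner product is `⟨x, y⟩_{2n} = ⟨A ^ n x, A ^ n y⟩`). -/
def evenLeftDefiniteSpace (A : H →ₗ.[ℂ] H) (n : ℕ) : Submodule ℂ H :=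
  (opPow A n).domain

/-- `w 0, …, w (N - 1)` are linearly independent modulo the subspace `V`. -/
def LinIndepModulo (V : Submodule ℂ H) {N : ℕ} (w : Fin N → H) : Prop :=
  ∀ α : Fin N → ℂ, ∑ i, α i • w i ∈ V → ∀ i, α i = 0

/-- The sesquilinear form of an operator `M` (to be used for a maximal operator):
`[f, g] = ⟨M f, g⟩ - ⟨f, M g⟩`, linear in `f` and conjugate linear in `g`. Mathlib's `inner ℂ x y`
is linear in `y`, so `⟨x, y⟩` is `inner ℂ y x`. -/
def boundaryForm (M : H →ₗ.[ℂ] H) (f g : M.domain) : ℂ :=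
  inner ℂ (g : H) (M f) - inner ℂ (M g) (f : H)

variable [CompleteSpace H]

/-- The defect space `{f ∈ D(A*) | A* f = z f}`. -/
def defectSpace (A : H →ₗ.[ℂ] H) (z : ℂ) : Submodule ℂ H where
  carrier := {f | ∃ h : f ∈ A.adjoint.domain, A.adjoint ⟨f, h⟩ = z • f}
  zero_mem' := ⟨A.adjoint.domain.zero_mem, by
    rw [smul_zero]; exact A.adjoint.map_zero⟩
  add_mem' := by
    rintro x y ⟨hx, hx'⟩ ⟨hy, hy'⟩
    refine ⟨A.adjoint.domain.add_mem hx hy, ?_⟩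
    rw [smul_add, ← hx', ← hy']
    exact A.adjoint.map_add ⟨x, hx⟩ ⟨y, hy⟩
  smul_mem' := by
    rintro c x ⟨hx, hx'⟩
    refine ⟨A.adjoint.domain.smul_mem c hx, ?_⟩
    rw [smul_comm, ← hx']
    exact A.adjoint.map_smul c ⟨x, hx⟩

/-- `A` has the (finite) deficiency indices `(p, q)`: the dimensions of the positive and of the
negative defect space. -/
def HasDeficiencyIndices (A : H →ₗ.[ℂ] H) (p q : ℕ) : Prop :=
  Module.rank ℂ (defectSpace A Complex.I) = p ∧
    Module.rank ℂ (defectSpace A (-Complex.I)) = q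

/-- The functions `w 0, …, w (N - 1)` are GKN conditions for the subspace `D`, with respect to
the minimal operator `S` and its maximal operator `S*`: they belong to the maximal domain, are
linearly independent modulo the minimal domain, satisfy the Glazman symmetry conditions
`[w j, w k] = 0`, and `D` consists exactly of the `f` in the maximal domain with
`[f, w k] = 0` for all `k`. -/
structure IsGKNConditions (S : H →ₗ.[ℂ] H) (D : Submodule ℂ H) {N : ℕ} (w : Fin N → H) :
    Prop where
  mem_max : ∀ k, w k ∈ S.adjoint.domain
  linIndep : LinIndepModulo S.domain w
  glazman : ∀ j k, boundaryForm S.adjoint ⟨w j, mem_max j⟩ ⟨w k, mem_max k⟩ = 0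
  mem_iff : ∀ f : H, f ∈ D ↔ ∃ hf : f ∈ S.adjoint.domain,
    ∀ k, boundaryForm S.adjoint ⟨f, hf⟩ ⟨w k, mem_max k⟩ = 0

end

end LeftDefinite

/-! All operators are restrictions of one everywhere defined linear map `T` to subspaces `S ≤ D ≤ M`
(minimal, self-adjoint, maximal), so their powers are `T ^ n` on the subspaces `powDom`. For nonreal
`w`, `T ^ n - w` is a product of `n` shifts `T - z` with every `z` nonreal (`exists_shiftProd_eq`).
Each such shift is a bijection from `D` onto `H`, is injective with closed range on `S`, and maps
`M` onto `H` with a kernel of dimension `m`. Working factor by factor gives the closedness of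
powers, their adjoints (`IsAdjPair.shiftProd_of_inner`, the delicate point) and the dimension `n *
m` of their defect spaces (`rank_shiftKer`).

The GKN conditions come from a general fact, applied to `T ^ n`. The shift by `i` identifies `D / S`
with `H` modulo the closed range of the minimal operator, hence with a defect space
(`rank_quotient_eq`). The image of `S + span P` under this shift is closed, since it contains that
range of finite codimension, and dense, since it contains every `P k`. So the eigenvectors span `D`
modulo `S` (`le_sup_span_eigenvectors`), and a basis of `D / S` can be chosen among them. The
boundary form vanishes on `D`, and an `f` annihilated by the chosen eigenvectors pairs symmetrically
with all of `D`, so self-adjointness puts it in `D`. -/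

namespace LeftDefinite

open Filter Topology Polynomial

/-! ### Powers and products of shifts on natural domains: pure linear algebra. -/

section Algebra

variable {H : Type*} [AddCommGroup H] [Module ℂ H]

/-- The natural domain of the `n`-th power of the restriction of `T` to `V`. -/
def powDom (T : Module.End ℂ H) (V : Submodule ℂ H) (n : ℕ) : Submodule ℂ H where
  carrier := {x | ∀ j < n, (T ^ j) x ∈ V}
  zero_mem' := fun j _ => by rw [map_zero]; exact V.zero_mem
  add_mem' := fun hx hy j hj => by rw [map_add]; exact V.add_mem (hx j hj) (hy j hj)
  smul_mem' := fun c x hx j hj => by rw [map_smul]; exact V.smul_mem c (hx j hj)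

/-- The product of the operators `T - z` over the entries `z` of a list. -/
def shiftProd (T : Module.End ℂ H) : List ℂ → Module.End ℂ H
  | [] => 1
  | z :: l => shiftProd T l * (T - z • 1)

variable {T : Module.End ℂ H} {V W : Submodule ℂ H}

theorem mem_powDom {n : ℕ} {x : H} : x ∈ powDom T V n ↔ ∀ j < n, (T ^ j) x ∈ V := Iff.rfl

theorem powDom_mono (h : V ≤ W) (n : ℕ) : powDom T V n ≤ powDom T W n :=
  fun _ hx j hj => h (hx j hj)

theorem powDom_anti {k n : ℕ} (h : k ≤ n) : powDom T V n ≤ powDom T V k :=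
  fun _ hx j hj => hx j (hj.trans_le h)

theorem mem_powDom_zero (x : H) : x ∈ powDom T V 0 := fun _ hj => absurd hj (Nat.not_lt_zero _)

theorem mem_powDom_one {x : H} : x ∈ powDom T V 1 ↔ x ∈ V := by
  simp [mem_powDom]

theorem mem_powDom_succ {n : ℕ} {x : H} :
    x ∈ powDom T V (n + 1) ↔ x ∈ V ∧ T x ∈ powDom T V n := by
  simp only [mem_powDom]
  constructor
  · intro h
    refine ⟨by simpa using h 0 n.succ_pos, fun j hj => ?_⟩
    simpa [pow_succ] using h (j + 1) (by omega)
  · rintro ⟨h0, h⟩ (_ | j) hj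
    · simpa using h0
    · simpa [pow_succ] using h j (by omega)

theorem mem_powDom_succ' {n : ℕ} {x : H} :
    x ∈ powDom T V (n + 1) ↔ x ∈ powDom T V n ∧ (T ^ n) x ∈ V := by
  simp only [mem_powDom]
  refine ⟨fun h => ⟨fun j hj => h j (by omega), h n (by omega)⟩, fun ⟨h, h'⟩ j hj => ?_⟩
  rcases Nat.lt_succ_iff_lt_or_eq.mp hj with hj | rfl
  exacts [h j hj, h']

theorem mem_powDom_succ_shift (z : ℂ) {n : ℕ} {x : H} :
    x ∈ powDom T V (n + 1) ↔ x ∈ V ∧ (T - z • 1) x ∈ powDom T V n := by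
  simp only [LinearMap.sub_apply, LinearMap.smul_apply, Module.End.one_apply]
  constructor
  · intro h
    have h' := mem_powDom_succ.mp h
    exact ⟨h'.1, sub_mem h'.2 (Submodule.smul_mem _ z (powDom_anti n.le_succ h))⟩
  · rintro ⟨h0, h⟩
    -- Induction on `j` with `T x = (T - z) x + z x`: the first term is controlled by `h`, the
    -- second by the previous stage.
    have key : ∀ j ≤ n + 1, x ∈ powDom T V j := by
      intro j
      induction j with
      | zero => exact fun _ => mem_powDom_zero x
      | succ j ih =>
        intro hj
        refine mem_powDom_succ.mpr ⟨h0, ?_⟩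
        have h1 := add_mem (powDom_anti (by omega : j ≤ n) h)
          (Submodule.smul_mem _ z (ih (by omega)))
        simpa using h1
    exact key _ le_rfl

theorem powDom_shift (z : ℂ) (n : ℕ) : powDom (T - z • 1) V n = powDom T V n := by
  induction n with
  | zero => exact le_antisymm (fun x _ => mem_powDom_zero x) (fun x _ => mem_powDom_zero x)
  | succ n ih => ext x; rw [mem_powDom_succ, ih, ← mem_powDom_succ_shift]

theorem shiftProd_cons_apply (z : ℂ) (l : List ℂ) (x : H) :
    shiftProd T (z :: l) x = shiftProd T l ((T - z • 1) x) := rfl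

theorem shiftProd_eq_aeval (T : Module.End ℂ H) (l : List ℂ) :
    shiftProd T l = aeval T (l.map (fun z => X - C z)).prod := by
  induction l with
  | nil => simp [shiftProd]
  | cons z l ih =>
    rw [shiftProd, ih, List.map_cons, List.prod_cons, mul_comm, map_mul]
    congr 1
    simp [Algebra.algebraMap_eq_smul_one]

/-- The factors commute, being polynomials in `T`. Peeling from the outer end is what adjoints
require, as they reverse the order of the factors. -/
theorem shiftProd_cons_apply' (z : ℂ) (l : List ℂ) (x : H) :
    shiftProd T (z :: l) x = (T - z • 1) (shiftProd T l x) := by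
  have h : Commute (shiftProd T l) (T - z • 1) := by
    have h1 : T - z • 1 = aeval T (X - C z) := by simp [Algebra.algebraMap_eq_smul_one]
    rw [shiftProd_eq_aeval, h1]
    exact (Commute.all _ _).map (aeval T)
  exact LinearMap.congr_fun h.eq x

theorem mem_powDom_add_length (l : List ℂ) {j : ℕ} {x : H} :
    x ∈ powDom T V (j + l.length) ↔ x ∈ powDom T V l.length ∧ shiftProd T l x ∈ powDom T V j := by
  induction l generalizing x with
  | nil => simp [shiftProd, mem_powDom_zero]
  | cons z l ih =>
    rw [List.length_cons, ← add_assoc, mem_powDom_succ_shift z, ih, mem_powDom_succ_shift z,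
      shiftProd_cons_apply, and_assoc]

theorem mem_powDom_length_succ (l : List ℂ) {x : H} :
    x ∈ powDom T V (l.length + 1) ↔ x ∈ powDom T V l.length ∧ shiftProd T l x ∈ V := by
  rw [add_comm, mem_powDom_add_length, mem_powDom_one]

/-- The kernel of the product of the `T - z` on the domain `powDom T V l.length`. -/
def shiftKer (T : Module.End ℂ H) (V : Submodule ℂ H) (l : List ℂ) : Submodule ℂ H :=
  powDom T V l.length ⊓ LinearMap.ker (shiftProd T l)

/-- The eigenspace of the restriction of `T` to `V`. -/
def eigDom (T : Module.End ℂ H) (V : Submodule ℂ H) (z : ℂ) : Submodule ℂ H :=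
  V ⊓ LinearMap.ker (T - z • 1)

theorem mem_eigDom {z : ℂ} {x : H} : x ∈ eigDom T V z ↔ x ∈ V ∧ T x = z • x := by
  simp [eigDom, sub_eq_zero]

theorem shiftProd_surj {l : List ℂ}
    (hs : ∀ z ∈ l, ∀ y, ∃ x ∈ V, (T - z • 1) x = y) (y : H) :
    ∃ x ∈ powDom T V l.length, shiftProd T l x = y := by
  induction l with
  | nil => exact ⟨y, mem_powDom_zero y, rfl⟩
  | cons z l ih =>
    obtain ⟨u, hu, rfl⟩ := ih fun z hz => hs z (List.mem_cons_of_mem _ hz)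
    obtain ⟨x, hx, rfl⟩ := hs z List.mem_cons_self u
    exact ⟨x, (mem_powDom_succ_shift z).mpr ⟨hx, hu⟩, rfl⟩

/-- Rank-nullity for `T - z`, which maps the kernel for `z :: l` onto the kernel for `l`, with
kernel the eigenspace at `z`; each factor adds `m`. -/
theorem rank_shiftKer {l : List ℂ} {m : ℕ}
    (hs : ∀ z ∈ l, ∀ y, ∃ x ∈ V, (T - z • 1) x = y)
    (hr : ∀ z ∈ l, Module.rank ℂ (eigDom T V z) = m) :
    Module.rank ℂ (shiftKer T V l) = (l.length * m : ℕ) := by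
  induction l with
  | nil =>
    have : shiftKer T V [] = ⊥ := by
      rw [eq_bot_iff]; exact fun x hx => hx.2
    rw [this]; simp
  | cons z l ih =>
    have hz := hs z List.mem_cons_self
    have hmem : ∀ x : shiftKer T V (z :: l), (T - z • 1) (x : H) ∈ shiftKer T V l := fun x =>
      ⟨((mem_powDom_succ_shift z).mp x.2.1).2, x.2.2⟩
    let f : shiftKer T V (z :: l) →ₗ[ℂ] shiftKer T V l :=
      ((T - z • 1) ∘ₗ (shiftKer T V (z :: l)).subtype).codRestrict _ hmem
    have hf : LinearMap.range f = ⊤ := by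
      rw [LinearMap.range_eq_top]
      rintro ⟨y, hy⟩
      obtain ⟨x, hx, hxy⟩ := hz y
      exact ⟨⟨x, (mem_powDom_succ_shift z).mpr ⟨hx, hxy ▸ hy.1⟩,
        (congrArg (shiftProd T l) hxy).trans hy.2⟩, Subtype.ext hxy⟩
    have hle : eigDom T V z ≤ shiftKer T V (z :: l) := fun x hx => by
      have h0 : (T - z • 1) x = 0 := hx.2
      exact ⟨(mem_powDom_succ_shift z).mpr ⟨hx.1, by rw [h0]; exact zero_mem _⟩,
        (congrArg (shiftProd T l) h0).trans (map_zero _)⟩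
    have hker : LinearMap.ker f = (eigDom T V z).submoduleOf (shiftKer T V (z :: l)) := by
      ext x
      rw [LinearMap.mem_ker, ← Subtype.coe_inj]
      exact ⟨fun h => ⟨((mem_powDom_succ_shift z).mp x.2.1).1, h⟩, fun h => h.2⟩
    rw [← LinearMap.rank_range_add_rank_ker f, hf, rank_top, hker,
      (Submodule.submoduleOfEquivOfLe hle).rank_eq, hr z List.mem_cons_self,
      ih (fun z hz => hs z (List.mem_cons_of_mem _ hz))
        (fun z hz => hr z (List.mem_cons_of_mem _ hz))]
    push_cast [List.length_cons]
    ring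

/-- If `f` is injective on `U ≤ V` and `f U = f V`, the kernel of `f` on `V` is a complement of
`U`. -/
theorem rank_ker_eq_rank_quotient {E : Type*} [AddCommGroup E] [Module ℂ E] (f : H →ₗ[ℂ] E)
    {U V : Submodule ℂ H} (hUV : U ≤ V)
    (hinj : ∀ x ∈ U, f x = 0 → x = 0) (hsurj : ∀ y ∈ V, ∃ x ∈ U, f x = f y) :
    Module.rank ℂ (V ⊓ LinearMap.ker f : Submodule ℂ H) =
      Module.rank ℂ (V ⧸ U.submoduleOf V) := by
  have hc : IsCompl (U.submoduleOf V) ((V ⊓ LinearMap.ker f).submoduleOf V) := by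
    constructor
    · rw [Submodule.disjoint_def]
      intro x hx hx'
      exact Subtype.ext (hinj x hx hx'.2)
    · rw [codisjoint_iff, Submodule.eq_top_iff']
      intro x
      obtain ⟨u, hu, hux⟩ := hsurj x x.2
      rw [Submodule.mem_sup]
      refine ⟨⟨u, hUV hu⟩, hu, x - ⟨u, hUV hu⟩, ⟨sub_mem x.2 (hUV hu), ?_⟩, by simp⟩
      simp [hux]
  rw [(Submodule.quotientEquivOfIsCompl _ _ hc).rank_eq,
    (Submodule.submoduleOfEquivOfLe inf_le_left).rank_eq]

/-- A polynomial factorization of `T ^ n - w` with factors `T - z`, together with the conjugate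
factorization. -/
theorem exists_shiftProd_eq (T : Module.End ℂ H) (n : ℕ) (hn : 1 ≤ n) (w : ℂ) (hw : w.im ≠ 0) :
    ∃ l : List ℂ, l.length = n ∧ (∀ z ∈ l, z.im ≠ 0) ∧
      shiftProd T l = T ^ n - w • 1 ∧
      shiftProd T (l.map (starRingEnd ℂ)) = T ^ n - (starRingEnd ℂ w) • 1 := by
  have hdeg : (X ^ n - C w : ℂ[X]).natDegree = n := natDegree_X_pow_sub_C
  have hmonic : (X ^ n - C w : ℂ[X]).Monic := monic_X_pow_sub_C w (by omega)
  have hsplit := IsAlgClosed.splits (X ^ n - C w : ℂ[X])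
  obtain ⟨l, hl⟩ := Quot.exists_rep (X ^ n - C w : ℂ[X]).roots
  have hl : (l : Multiset ℂ) = (X ^ n - C w : ℂ[X]).roots := hl
  have hprod : (l.map (fun z => X - C z)).prod = (X ^ n - C w : ℂ[X]) := by
    rw [← Multiset.prod_coe, ← Multiset.map_coe, hl]
    exact (hsplit.eq_prod_roots_of_monic hmonic).symm
  refine ⟨l, ?_, ?_, ?_, ?_⟩
  · rw [← Multiset.coe_card, hl, ← hsplit.natDegree_eq_card_roots, hdeg]
  -- A real root `z` would make `w = z ^ n` real.
  · intro z hz hzim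
    have hz' : z ∈ (X ^ n - C w : ℂ[X]).roots := by rw [← hl]; exact hz
    have h1 := (mem_roots'.mp hz').2
    simp only [IsRoot.def, eval_sub, eval_pow, eval_X, eval_C, sub_eq_zero] at h1
    apply hw
    rw [← h1]
    have : z = ((z.re : ℝ) : ℂ) := Complex.ext rfl (by simp [hzim])
    rw [this, ← Complex.ofReal_pow, Complex.ofReal_im]
  · rw [shiftProd_eq_aeval, hprod]
    simp [Algebra.algebraMap_eq_smul_one]
  · have : ((l.map (starRingEnd ℂ)).map (fun z => X - C z)).prod =
        (X ^ n - C (starRingEnd ℂ w) : ℂ[X]) := by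
      -- Conjugating the coefficients of the first factorization conjugates its roots.
      have h2 := congrArg (Polynomial.map (starRingEnd ℂ)) hprod
      rw [Polynomial.map_list_prod] at h2
      simp only [List.map_map, Polynomial.map_sub, Polynomial.map_pow, map_X, map_C] at h2
      rw [← h2, List.map_map]
      congr 2
      funext z
      simp
    rw [shiftProd_eq_aeval, this]
    simp [Algebra.algebraMap_eq_smul_one]

end Algebra

/-! ### Adjoint pairs, symmetry and closedness for restrictions of `T`. -/

section Hilbert

variable {H : Type*} [NormedAddCommGroup H] [InnerProductSpace ℂ H]
variable {T : Module.End ℂ H} {U V W : Submodule ℂ H}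

/-- The restriction of `T` to `W` is the adjoint of the restriction of `T` to `V`. -/
def IsAdjPair (T : Module.End ℂ H) (V W : Submodule ℂ H) : Prop :=
  ∀ φ g : H, (∀ y ∈ V, inner ℂ φ (T y) = inner ℂ g y) ↔ φ ∈ W ∧ T φ = g

/-- The restriction of `T` to `V` is symmetric. -/
def IsSymmOn (T : Module.End ℂ H) (V : Submodule ℂ H) : Prop :=
  ∀ x ∈ V, ∀ y ∈ V, inner ℂ (T x) y = inner ℂ x (T y)

/-- The restriction of `T` to `V` is a closed operator. -/
def IsClosedOn (T : Module.End ℂ H) (V : Submodule ℂ H) : Prop :=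
  ∀ (u : ℕ → H) (x y : H), (∀ k, u k ∈ V) → Tendsto u atTop (𝓝 x) →
    Tendsto (fun k => T (u k)) atTop (𝓝 y) → x ∈ V ∧ T x = y

theorem IsAdjPair.inner_eq (h : IsAdjPair T V W) {x y : H} (hx : x ∈ W) (hy : y ∈ V) :
    inner ℂ (T x) y = inner ℂ x (T y) :=
  (((h x (T x)).mpr ⟨hx, rfl⟩) y hy).symm

theorem IsAdjPair.isSymmOn (h : IsAdjPair T V V) : IsSymmOn T V :=
  fun _ hx _ hy => h.inner_eq hx hy

theorem IsSymmOn.mono (h : IsSymmOn T V) (hUV : U ≤ V) : IsSymmOn T U :=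
  fun _ hx _ hy => h _ (hUV hx) _ (hUV hy)

theorem IsAdjPair.isClosedOn (h : IsAdjPair T V W) : IsClosedOn T W := by
  intro u x y hu hx hy
  refine (h x y).mp fun v hv => ?_
  have h1 : Tendsto (fun k => inner ℂ (u k) (T v)) atTop (𝓝 (inner ℂ x (T v))) :=
    hx.inner tendsto_const_nhds
  have h2 : Tendsto (fun k => inner ℂ (T (u k)) v) atTop (𝓝 (inner ℂ y v)) :=
    hy.inner tendsto_const_nhds
  refine tendsto_nhds_unique h1 (h2.congr fun k => h.inner_eq (hu k) hv)

/-- By symmetry `⟨x, T x⟩` is real, so only `z` contributes to the imaginary part of `⟨x, (T - z)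
x⟩`; Cauchy–Schwarz does the rest. -/
theorem IsSymmOn.im_mul_norm_le (h : IsSymmOn T V) (z : ℂ) {x : H} (hx : x ∈ V) :
    |z.im| * ‖x‖ ≤ ‖(T - z • 1) x‖ := by
  have h1 : (inner ℂ x (T x)).im = 0 := by
    have h2 : starRingEnd ℂ (inner ℂ x (T x)) = inner ℂ x (T x) := by
      rw [inner_conj_symm, h x hx x hx]
    exact Complex.conj_eq_iff_im.mp h2
  have h3 : (inner ℂ x ((T - z • 1) x)).im = -(z.im * ‖x‖ ^ 2) := by
    simp only [LinearMap.sub_apply, LinearMap.smul_apply, Module.End.one_apply, inner_sub_right,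
      inner_smul_right, Complex.sub_im, h1, inner_self_eq_norm_sq_to_K]
    rw [zero_sub, Complex.mul_im]
    simp [← Complex.ofReal_pow]
  have h4 : |z.im| * ‖x‖ ^ 2 ≤ ‖x‖ * ‖(T - z • 1) x‖ := by
    calc |z.im| * ‖x‖ ^ 2 = |(inner ℂ x ((T - z • 1) x)).im| := by
          rw [h3, abs_neg, abs_mul, abs_of_nonneg (sq_nonneg ‖x‖)]
      _ ≤ ‖inner ℂ x ((T - z • 1) x)‖ := Complex.abs_im_le_norm _
      _ ≤ _ := norm_inner_le_norm _ _
  rcases (norm_nonneg x).eq_or_lt with h5 | h5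
  · rw [← h5, mul_zero]; exact norm_nonneg _
  · refine le_of_mul_le_mul_left ?_ h5
    linarith [h4]

theorem IsSymmOn.shift_inj (h : IsSymmOn T V) {z : ℂ} (hz : z.im ≠ 0) {x : H} (hx : x ∈ V)
    (h0 : (T - z • 1) x = 0) : x = 0 := by
  have h1 := h.im_mul_norm_le z hx
  rw [h0, norm_zero] at h1
  have h2 : 0 < |z.im| := abs_pos.mpr hz
  exact norm_le_zero_iff.mp (nonpos_of_mul_nonpos_right h1 h2)

theorem IsAdjPair.inner_shift (h : IsAdjPair T V W) (z : ℂ) {x y : H} (hx : x ∈ W) (hy : y ∈ V) :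
    inner ℂ ((T - (starRingEnd ℂ z) • 1) x) y = inner ℂ x ((T - z • 1) y) := by
  simp only [LinearMap.sub_apply, LinearMap.smul_apply, Module.End.one_apply, inner_sub_left,
    inner_sub_right, inner_smul_left, inner_smul_right, Complex.conj_conj, h.inner_eq hx hy]

theorem IsAdjPair.mem_eigDom_of_inner (h : IsAdjPair T V W) (z : ℂ) {φ : H}
    (h0 : ∀ y ∈ V, inner ℂ φ ((T - z • 1) y) = 0) :
    φ ∈ eigDom T W (starRingEnd ℂ z) := by
  rw [mem_eigDom]
  refine (h φ _).mp fun y hy => ?_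
  have := h0 y hy
  simp only [LinearMap.sub_apply, LinearMap.smul_apply, Module.End.one_apply, inner_sub_right,
    inner_smul_right, sub_eq_zero] at this
  rw [this, inner_smul_left, Complex.conj_conj]

theorem IsAdjPair.inner_shiftProd (h : IsAdjPair T V W) (l : List ℂ) {x y : H}
    (hx : x ∈ powDom T W l.length) (hy : y ∈ powDom T V l.length) :
    inner ℂ (shiftProd T (l.map (starRingEnd ℂ)) x) y = inner ℂ x (shiftProd T l y) := by
  induction l generalizing y with
  | nil => rfl
  | cons z l ih =>
    have h1 := (mem_powDom_length_succ (l.map (starRingEnd ℂ))).mp (by simpa using hx)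
    have h2 := (mem_powDom_succ_shift z).mp hy
    rw [List.map_cons, shiftProd_cons_apply', shiftProd_cons_apply, h.inner_shift z h1.2 h2.1,
      ih (by simpa using h1.1) h2.2]

/-- A linear functional that vanishes where finitely many inner products vanish is itself an inner
product. -/
theorem exists_inner_eq (K V : Submodule ℂ H) [FiniteDimensional ℂ K] (f : H →ₗ[ℂ] ℂ)
    (hf : ∀ u ∈ V, (∀ k ∈ K, inner ℂ k u = 0) → f u = 0) :
    ∃ k ∈ K, ∀ u ∈ V, f u = inner ℂ k u := by
  let b := Module.finBasis ℂ K
  let L : Fin (Module.finrank ℂ K) → (V →ₗ[ℂ] ℂ) := fun i =>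
    (innerₛₗ ℂ (b i : H)).comp V.subtype
  have hmem : f.comp V.subtype ∈ Submodule.span ℂ (Set.range L) := by
    -- A functional vanishing on the common kernel of finitely many functionals is a combination of
    -- them.
    refine mem_span_of_iInf_ker_le_ker fun u hu => ?_
    refine hf u u.2 fun k hk => ?_
    have h1 : (⟨k, hk⟩ : K) ∈ Submodule.span ℂ (Set.range b) := by rw [b.span_eq]; trivial
    refine Submodule.span_induction (p := fun (k : K) _ => inner ℂ (k : H) (u : H) = 0)
      ?_ ?_ ?_ ?_ h1
    · rintro _ ⟨i, rfl⟩
      exact (Submodule.mem_iInf _).mp hu i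
    · simp
    · intro x y _ _ hx hy
      rw [Submodule.coe_add, inner_add_left, hx, hy, add_zero]
    · intro a x _ hx
      rw [Submodule.coe_smul, inner_smul_left, hx, mul_zero]
  obtain ⟨k, hk, hk'⟩ : ∃ k ∈ K, ∀ u : V, (f.comp V.subtype) u = inner ℂ k (u : H) := by
    refine Submodule.span_induction (p := fun (g : V →ₗ[ℂ] ℂ) _ =>
      ∃ k ∈ K, ∀ u : V, g u = inner ℂ k (u : H)) ?_ ?_ ?_ ?_ hmem
    · rintro _ ⟨i, rfl⟩
      exact ⟨b i, (b i).2, fun u => rfl⟩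
    · exact ⟨0, K.zero_mem, by simp⟩
    · rintro g g' _ _ ⟨k, hk, h⟩ ⟨k', hk', h'⟩
      exact ⟨k + k', add_mem hk hk', fun u => by
        rw [LinearMap.add_apply, h, h', inner_add_left]⟩
    · rintro a g _ ⟨k, hk, h⟩
      exact ⟨starRingEnd ℂ a • k, K.smul_mem _ hk, fun u => by
        rw [LinearMap.smul_apply, h, inner_smul_left, Complex.conj_conj, smul_eq_mul]⟩
  exact ⟨k, hk, fun u hu => hk' ⟨u, hu⟩⟩

theorem IsAdjPair.inner_pow (h : IsAdjPair T V W) (n : ℕ) {x y : H}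
    (hx : x ∈ powDom T W n) (hy : y ∈ powDom T V n) :
    inner ℂ ((T ^ n) x) y = inner ℂ x ((T ^ n) y) := by
  have key := h.inner_shiftProd (List.replicate n 0) (by simpa using hx) (by simpa using hy)
  have hprod : ∀ k, shiftProd T (List.replicate k 0) = T ^ k := fun k => by
    induction k with
    | zero => rfl
    | succ k ih => rw [List.replicate_succ, shiftProd, ih, zero_smul, sub_zero, pow_succ]
  simpa [hprod] using key

/-! ### Closed ranges, and adjoints of products and powers. -/

variable [CompleteSpace H]

/-- The lower bound `|Im z| ‖x‖ ≤ ‖(T - z) x‖` turns convergence of the images into a Cauchy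
condition on `u`. -/
theorem IsSymmOn.exists_limit_shift (h : IsSymmOn T V) (hc : IsClosedOn T V) {z : ℂ}
    (hz : z.im ≠ 0) {u : ℕ → H} {y : H} (hu : ∀ k, u k ∈ V)
    (hy : Tendsto (fun k => (T - z • 1) (u k)) atTop (𝓝 y)) :
    ∃ x ∈ V, Tendsto u atTop (𝓝 x) ∧ (T - z • 1) x = y := by
  have hz' : 0 < |z.im| := abs_pos.mpr hz
  have hcau : CauchySeq u := by
    rw [Metric.cauchySeq_iff]
    intro ε hε
    obtain ⟨N, hN⟩ := Metric.cauchySeq_iff.mp hy.cauchySeq (|z.im| * ε) (mul_pos hz' hε)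
    refine ⟨N, fun j hj k hk => ?_⟩
    have h1 := hN j hj k hk
    rw [dist_eq_norm, ← map_sub] at h1
    have h2 := h.im_mul_norm_le z (sub_mem (hu j) (hu k))
    rw [dist_eq_norm]
    exact lt_of_mul_lt_mul_left (h2.trans_lt h1) hz'.le
  obtain ⟨x, hx⟩ := cauchySeq_tendsto_of_complete hcau
  have hT : Tendsto (fun k => T (u k)) atTop (𝓝 (y + z • x)) := by
    refine (hy.add (hx.const_smul z)).congr fun k => ?_
    simp
  obtain ⟨h1, h2⟩ := hc u x _ hu hx hT
  exact ⟨x, h1, hx, by simp [h2]⟩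

theorem IsSymmOn.exists_limit_shiftProd (h : IsSymmOn T V) (hc : IsClosedOn T V) {l : List ℂ}
    (hl : ∀ z ∈ l, z.im ≠ 0) {u : ℕ → H} {y : H} (hu : ∀ k, u k ∈ powDom T V l.length)
    (hy : Tendsto (fun k => shiftProd T l (u k)) atTop (𝓝 y)) :
    ∃ x ∈ powDom T V l.length, Tendsto u atTop (𝓝 x) ∧ shiftProd T l x = y := by
  induction l generalizing u with
  | nil => exact ⟨y, mem_powDom_zero y, hy, rfl⟩
  | cons z l ih =>
    obtain ⟨v, hv, hv', rfl⟩ := ih (fun z hz => hl z (List.mem_cons_of_mem _ hz))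
      (fun k => ((mem_powDom_succ_shift z).mp (hu k)).2) hy
    obtain ⟨x, hx, hx', rfl⟩ := h.exists_limit_shift hc (hl z List.mem_cons_self)
      (fun k => ((mem_powDom_succ_shift z).mp (hu k)).1) hv'
    exact ⟨x, (mem_powDom_succ_shift z).mpr ⟨hx, hv⟩, hx', rfl⟩

theorem IsSymmOn.isClosed_map_shift (h : IsSymmOn T V) (hc : IsClosedOn T V) {z : ℂ}
    (hz : z.im ≠ 0) : IsClosed ((V.map (T - z • 1) : Submodule ℂ H) : Set H) := by
  rw [← isSeqClosed_iff_isClosed]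
  intro v y hv hy
  choose u hu huv using hv
  obtain ⟨x, hx, -, hxy⟩ := h.exists_limit_shift hc hz (u := u) (y := y) hu
    (by simpa only [huv] using hy)
  exact ⟨x, hx, hxy⟩

/-- Vectors orthogonal to the defect space lie in the range of the shifted symmetric operator. -/
theorem IsAdjPair.exists_shift_eq (h : IsAdjPair T V W) (hs : IsSymmOn T V) (hc : IsClosedOn T V)
    {z : ℂ} (hz : z.im ≠ 0) {y : H}
    (hy : ∀ k ∈ eigDom T W (starRingEnd ℂ z), inner ℂ k y = 0) :
    ∃ x ∈ V, (T - z • 1) x = y := by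
  have hcl := hs.isClosed_map_shift hc hz
  have : CompleteSpace (V.map (T - z • 1) : Submodule ℂ H) := hcl.completeSpace_coe
  have : y ∈ ((V.map (T - z • 1))ᗮ)ᗮ := by
    rw [Submodule.mem_orthogonal]
    intro k hk
    refine hy k (h.mem_eigDom_of_inner z fun v hv => ?_)
    exact (Submodule.mem_orthogonal' _ _).mp hk _ ⟨v, hv, rfl⟩
  rw [Submodule.orthogonal_orthogonal] at this
  exact this

theorem IsAdjPair.shift_surj (h : IsAdjPair T V V) {z : ℂ} (hz : z.im ≠ 0) (y : H) :
    ∃ x ∈ V, (T - z • 1) x = y := by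
  refine h.exists_shift_eq h.isSymmOn h.isClosedOn hz fun k hk => ?_
  have : k = 0 := h.isSymmOn.shift_inj (by simpa using hz) hk.1 hk.2
  rw [this, inner_zero_left]

/-- If the adjoint shifts are onto and the defect spaces are finite-dimensional, the adjoint of a
product of shifts is the product of the adjoints. -/
theorem IsAdjPair.shiftProd_of_inner (h : IsAdjPair T V W) (hs : IsSymmOn T V)
    (hc : IsClosedOn T V) {l : List ℂ} (hl : ∀ z ∈ l, z.im ≠ 0)
    (hsurj : ∀ z : ℂ, z.im ≠ 0 → ∀ y, ∃ x ∈ W, (T - z • 1) x = y)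
    (hfin : ∀ z : ℂ, z.im ≠ 0 → FiniteDimensional ℂ (eigDom T W z)) {φ g : H}
    (hφ : ∀ y ∈ powDom T V l.length, inner ℂ φ (shiftProd T l y) = inner ℂ g y) :
    φ ∈ powDom T W l.length ∧ shiftProd T (l.map (starRingEnd ℂ)) φ = g := by
  induction l generalizing φ g with
  | nil => exact ⟨mem_powDom_zero φ, ext_inner_right ℂ fun y => hφ y (mem_powDom_zero y)⟩
  | cons z l ih =>
    have hz := hl z List.mem_cons_self
    -- Subtracting a solution `η` of the adjoint equation reduces to a vector `φ - η` orthogonal to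
    -- the range of the product.
    obtain ⟨η, hη, rfl⟩ := shiftProd_surj (T := T) (V := W)
      (l := (z :: l).map (starRingEnd ℂ)) (by
        intro w hw
        obtain ⟨w', hw', rfl⟩ := List.mem_map.mp hw
        exact hsurj _ (by simpa using hl w' hw')) g
    rw [List.length_map] at hη
    have hψ : ∀ y ∈ powDom T V (z :: l).length,
        inner ℂ (φ - η) (shiftProd T (z :: l) y) = 0 := fun y hy => by
      rw [inner_sub_left, hφ y hy, h.inner_shiftProd _ hη hy, sub_self]
    have := hfin (starRingEnd ℂ z) (by simpa using hz)
    -- The functional `u ↦ ⟨φ - η, shiftProd T l u⟩` vanishes on each `u` in this domain orthogonal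
    -- to the defect space, as such a `u` is `(T - z) x` with `x` in the domain for `z :: l`. It is
    -- therefore represented by a defect vector `k`, to which the induction hypothesis applies; the
    -- remaining factor kills `k`.
    obtain ⟨k, hk, hk'⟩ := exists_inner_eq (eigDom T W (starRingEnd ℂ z)) (powDom T V l.length)
      ((innerₛₗ ℂ (φ - η)).comp (shiftProd T l)) (by
        intro u hu hu'
        obtain ⟨x, hx, rfl⟩ := h.exists_shift_eq hs hc hz hu'
        exact hψ x ((mem_powDom_succ_shift z).mpr ⟨hx, hu⟩))
    obtain ⟨h1, h2⟩ := ih (fun z hz => hl z (List.mem_cons_of_mem _ hz)) hk'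
    have h3 : φ - η ∈ powDom T W (z :: l).length := by
      have := (mem_powDom_length_succ (T := T) (V := W) (x := φ - η)
        (l.map (starRingEnd ℂ))).mpr ⟨by simpa using h1, by rw [h2]; exact hk.1⟩
      simpa using this
    have h4 : shiftProd T ((z :: l).map (starRingEnd ℂ)) (φ - η) = 0 := by
      rw [List.map_cons, shiftProd_cons_apply', h2]
      exact hk.2
    refine ⟨?_, ?_⟩
    · have := add_mem h3 hη
      rwa [sub_add_cancel] at this
    · rwa [map_sub, sub_eq_zero] at h4

theorem IsAdjPair.pow (h : IsAdjPair T V W) (hs : IsSymmOn T V) (hc : IsClosedOn T V)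
    (hsurj : ∀ z : ℂ, z.im ≠ 0 → ∀ y, ∃ x ∈ W, (T - z • 1) x = y)
    (hfin : ∀ z : ℂ, z.im ≠ 0 → FiniteDimensional ℂ (eigDom T W z)) {n : ℕ} (hn : 1 ≤ n) :
    IsAdjPair (T ^ n) (powDom T V n) (powDom T W n) := by
  intro φ g
  constructor
  · intro hφ
    -- The choice of `i` is immaterial: shifting `T ^ n` by any nonreal number makes all factors
    -- nonreal, and only replaces `g` by `g` minus a multiple of `φ`.
    obtain ⟨l, hlen, hl, h1, h2⟩ := exists_shiftProd_eq T n hn Complex.I (by simp)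
    obtain ⟨h3, h4⟩ := h.shiftProd_of_inner hs hc hl hsurj hfin (φ := φ)
      (g := g - (starRingEnd ℂ Complex.I) • φ) (fun y hy => by
        rw [hlen] at hy
        rw [h1]
        simp only [LinearMap.sub_apply, LinearMap.smul_apply, Module.End.one_apply,
          inner_sub_right, inner_sub_left, inner_smul_left, inner_smul_right, Complex.conj_conj,
          hφ y hy])
    rw [hlen] at h3
    rw [h2] at h4
    exact ⟨h3, by simpa using h4⟩
  · rintro ⟨h1, rfl⟩ y hy
    exact (h.inner_pow n h1 hy).symm

theorem IsSymmOn.isClosedOn_pow (h : IsSymmOn T V) (hc : IsClosedOn T V) {n : ℕ} (hn : 1 ≤ n) :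
    IsClosedOn (T ^ n) (powDom T V n) := by
  intro u x y hu hx hy
  obtain ⟨l, rfl, hl, h1, -⟩ := exists_shiftProd_eq T n hn Complex.I (by simp)
  obtain ⟨x', hx', hux', h2⟩ := h.exists_limit_shiftProd hc hl hu (y := y - Complex.I • x) (by
    rw [h1]
    exact hy.sub (hx.const_smul _))
  obtain rfl := tendsto_nhds_unique hx hux'
  refine ⟨hx', ?_⟩
  rw [h1] at h2
  simpa using h2

end Hilbert

/-! ### Dimension counts relative to a self-adjoint extension. -/

section Extension

variable {H : Type*} [NormedAddCommGroup H] [InnerProductSpace ℂ H]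
variable {T : Module.End ℂ H} {V L W : Submodule ℂ H}

theorem IsAdjPair.le_of_le (h : IsAdjPair T V W) (hL : IsAdjPair T L L) (hVL : V ≤ L) : L ≤ W :=
  fun x hx => ((h x (T x)).mp fun _ hy => (hL.inner_eq hx (hVL hy)).symm).1

/-- The classes of the `P k` span the `N`-dimensional quotient `L / V`, so a basis can be extracted
from them. -/
theorem exists_basis_modulo (hVL : V ≤ L) {N : ℕ}
    (hN : Module.rank ℂ (L ⧸ V.submoduleOf L) = N) {P : ℕ → H} (hPL : ∀ k, P k ∈ L)
    (hspan : L ≤ V ⊔ Submodule.span ℂ (Set.range P)) :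
    ∃ κ : Fin N → ℕ, Function.Injective κ ∧ LinIndepModulo V (fun i => P (κ i)) ∧
      ∀ x ∈ L, ∃ c : Fin N → ℂ, x - ∑ i, c i • P (κ i) ∈ V := by
  let q := (V.submoduleOf L).mkQ
  let v : ℕ → L ⧸ V.submoduleOf L := fun k => q ⟨P k, hPL k⟩
  have hq : ∀ x : L, q x = 0 ↔ (x : H) ∈ V := fun x => Submodule.Quotient.mk_eq_zero _
  have hv : Submodule.span ℂ (Set.range v) = ⊤ := by
    have hle : V ⊔ Submodule.span ℂ (Set.range P) ≤
        ((Submodule.span ℂ (Set.range v)).comap q).map L.subtype := by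
      refine sup_le (fun x hx => ⟨⟨x, hVL hx⟩, ?_, rfl⟩) (Submodule.span_le.mpr ?_)
      · change q ⟨x, hVL hx⟩ ∈ Submodule.span ℂ (Set.range v)
        rw [(hq _).mpr hx]
        exact zero_mem _
      · rintro _ ⟨k, rfl⟩
        exact ⟨⟨P k, hPL k⟩, Submodule.subset_span ⟨k, rfl⟩, rfl⟩
    rw [Submodule.eq_top_iff']
    intro y
    obtain ⟨x, rfl⟩ := (V.submoduleOf L).mkQ_surjective y
    obtain ⟨x', hx', hxx'⟩ := hle (hspan x.2)
    rw [← (Subtype.ext hxx' : x' = x)]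
    exact hx'
  obtain ⟨ι, a, ha, hspan', hli⟩ := exists_linearIndependent' ℂ v
  let b : Module.Basis ι ℂ (L ⧸ V.submoduleOf L) :=
    Module.Basis.mk hli (by rw [hspan', hv])
  have : FiniteDimensional ℂ (L ⧸ V.submoduleOf L) :=
    Module.rank_lt_aleph0_iff.mp (hN ▸ Cardinal.natCast_lt_aleph0)
  have : Fintype ι := FiniteDimensional.fintypeBasisIndex b
  have hcard : Fintype.card ι = N := by
    rw [← Module.finrank_eq_card_basis b, Module.finrank_eq_of_rank_eq hN]
  let e : Fin N ≃ ι := (Fintype.equivFinOfCardEq hcard).symm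
  have hsum : ∀ c : Fin N → ℂ,
      q (∑ i, c i • ⟨P (a (e i)), hPL (a (e i))⟩) = ∑ i, c i • v (a (e i)) := fun c => by
    simp only [v, map_sum, map_smul]
  have hcoe : ∀ c : Fin N → ℂ, ((∑ i, c i • ⟨P (a (e i)), hPL (a (e i))⟩ : L) : H) =
      ∑ i, c i • P (a (e i)) := fun c => by simp
  refine ⟨a ∘ e, ha.comp e.injective, fun α hα => ?_, fun x hx => ?_⟩
  · have h1 := (hq (∑ i, α i • ⟨P (a (e i)), hPL (a (e i))⟩)).mpr (by rw [hcoe]; exact hα)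
    rw [hsum] at h1
    exact Fintype.linearIndependent_iff.mp (hli.comp e e.injective) α h1
  · have h1 : q ⟨x, hx⟩ ∈ Submodule.span ℂ (Set.range ((v ∘ a) ∘ e)) := by
      rw [e.surjective.range_comp, hspan', hv]; trivial
    obtain ⟨c, hc⟩ := (Submodule.mem_span_range_iff_exists_fun ℂ).mp h1
    refine ⟨c, ?_⟩
    have h2 := (hq (⟨x, hx⟩ - ∑ i, c i • ⟨P (a (e i)), hPL (a (e i))⟩)).mp (by
      rw [map_sub, hsum, sub_eq_zero]; exact hc.symm)
    rwa [Submodule.coe_sub, hcoe] at h2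

variable [CompleteSpace H]

/-- Every defect space is a complement of the domain of a fixed self-adjoint extension. -/
theorem rank_eigDom_eq (hL : IsAdjPair T L L) (hLW : L ≤ W) {z : ℂ} (hz : z.im ≠ 0) :
    Module.rank ℂ (eigDom T W z) = Module.rank ℂ (W ⧸ L.submoduleOf W) :=
  rank_ker_eq_rank_quotient (T - z • 1) hLW (fun _ hx h0 => hL.isSymmOn.shift_inj hz hx h0)
    fun y _ => hL.shift_surj hz ((T - z • 1) y)

theorem rank_eigDom_pow (hL : IsAdjPair T L L) (hLW : L ≤ W) {m : ℕ}
    (hm : Module.rank ℂ (eigDom T W Complex.I) = m) {n : ℕ} (hn : 1 ≤ n) {w : ℂ} (hw : w.im ≠ 0) :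
    Module.rank ℂ (eigDom (T ^ n) (powDom T W n) w) = (n * m : ℕ) := by
  obtain ⟨l, rfl, hl, h1, -⟩ := exists_shiftProd_eq T n hn w hw
  have h2 := rank_shiftKer (T := T) (V := W) (l := l) (m := m)
    (fun z hz y => by
      obtain ⟨x, hx, hxy⟩ := hL.shift_surj (hl z hz) y
      exact ⟨x, hLW hx, hxy⟩)
    (fun z hz => by
      -- Both defect spaces have the dimension of `W / L`, so the index at `i` determines the one at
      -- every nonreal `z`.
      rw [rank_eigDom_eq hL hLW (hl z hz), ← hm, rank_eigDom_eq hL hLW (by simp)])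
  rw [← h2, shiftKer, h1, eigDom]

/-- The bijection `T - z` from `L` onto `H` carries `V` to a closed subspace `R`, so `L / V ≅ H / R
≅ Rᗮ`, and `Rᗮ` is the defect space at the conjugate of `z`. -/
theorem rank_quotient_eq (h : IsAdjPair T V W) (hL : IsAdjPair T L L) (hVL : V ≤ L)
    (hc : IsClosedOn T V) {z : ℂ} (hz : z.im ≠ 0) :
    Module.rank ℂ (L ⧸ V.submoduleOf L) = Module.rank ℂ (eigDom T W (starRingEnd ℂ z)) ∧
      Module.rank ℂ (H ⧸ V.map (T - z • 1)) = Module.rank ℂ (eigDom T W (starRingEnd ℂ z)) := by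
  have hLW := h.le_of_le hL hVL
  set R := V.map (T - z • 1) with hR
  have : CompleteSpace R :=
    ((hL.isSymmOn.mono hVL).isClosed_map_shift hc hz).completeSpace_coe
  have horth : Rᗮ = eigDom T W (starRingEnd ℂ z) := by
    ext φ
    constructor
    · intro hφ
      exact h.mem_eigDom_of_inner z fun v hv =>
        (Submodule.mem_orthogonal' _ _).mp hφ _ ⟨v, hv, rfl⟩
    · intro hφ
      rw [Submodule.mem_orthogonal']
      rintro _ ⟨v, hv, rfl⟩
      have h0 : (T - (starRingEnd ℂ z) • 1) φ = 0 := hφ.2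
      rw [← h.inner_shift z hφ.1 hv, h0, inner_zero_left]
  have h2 : Module.rank ℂ (H ⧸ R) = Module.rank ℂ (eigDom T W (starRingEnd ℂ z)) := by
    rw [← horth]
    exact (Submodule.quotientEquivOfIsCompl R Rᗮ R.isCompl_orthogonal).rank_eq
  refine ⟨?_, h2⟩
  let f : L →ₗ[ℂ] H ⧸ R := R.mkQ ∘ₗ (T - z • 1) ∘ₗ L.subtype
  have hf : Function.Surjective f := by
    intro y
    obtain ⟨y, rfl⟩ := R.mkQ_surjective y
    obtain ⟨x, hx, rfl⟩ := hL.shift_surj hz y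
    exact ⟨⟨x, hx⟩, rfl⟩
  have hker : V.submoduleOf L = LinearMap.ker f := by
    ext x
    change (x : H) ∈ V ↔ R.mkQ ((T - z • 1) (x : H)) = 0
    rw [Submodule.mkQ_apply, Submodule.Quotient.mk_eq_zero]
    constructor
    · intro hx; exact ⟨x, hx, rfl⟩
    · rintro ⟨v, hv, hvx⟩
      have : v - x = 0 := hL.isSymmOn.shift_inj hz (sub_mem (hVL hv) x.2)
        (by rw [map_sub, hvx, sub_self])
      rwa [← sub_eq_zero.mp this]
  rw [hker, ← h2]
  exact (LinearMap.quotKerEquivOfSurjective f hf).rank_eq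

/-- The eigenvectors span the self-adjoint domain modulo the minimal one. -/
theorem le_sup_span_eigenvectors (h : IsAdjPair T V W) (hL : IsAdjPair T L L) (hVL : V ≤ L)
    (hc : IsClosedOn T V) {N : ℕ} (hN : Module.rank ℂ (eigDom T W (-Complex.I)) = N)
    {P : ℕ → H} (hP0 : ∀ k, P k ≠ 0) (hPL : ∀ k, P k ∈ L) (hP : ∀ k, ∃ μ : ℂ, T (P k) = μ • P k)
    (hPd : Dense (Submodule.span ℂ (Set.range P) : Set H)) :
    L ≤ V ⊔ Submodule.span ℂ (Set.range P) := by
  have hz : Complex.I.im ≠ 0 := by simp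
  have hXL : V ⊔ Submodule.span ℂ (Set.range P) ≤ L :=
    sup_le hVL (Submodule.span_le.mpr (by rintro _ ⟨k, rfl⟩; exact hPL k))
  set X := V ⊔ Submodule.span ℂ (Set.range P) with hX
  have hrank := (rank_quotient_eq h hL hVL hc hz).2
  rw [Complex.conj_I, hN] at hrank
  have : FiniteDimensional ℂ (H ⧸ V.map (T - Complex.I • 1)) :=
    Module.rank_lt_aleph0_iff.mp (hrank ▸ Cardinal.natCast_lt_aleph0)
  have hclosed : IsClosed ((X.map (T - Complex.I • 1) : Submodule ℂ H) : Set H) :=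
    Submodule.isClosed_mono_of_finiteDimensional_quotient
      ((hL.isSymmOn.mono hVL).isClosed_map_shift hc hz) (Submodule.map_mono le_sup_left)
  have hspan : Submodule.span ℂ (Set.range P) ≤ X.map (T - Complex.I • 1) := by
    rw [Submodule.span_le]
    rintro _ ⟨k, rfl⟩
    obtain ⟨μ, hμ⟩ := hP k
    have h1 : (T - Complex.I • 1) (P k) = (μ - Complex.I) • P k := by simp [hμ, sub_smul]
    -- A symmetric operator cannot have the eigenvalue `i`.
    have h2 : μ - Complex.I ≠ 0 := fun h0 =>
      hP0 k (hL.isSymmOn.shift_inj hz (hPL k) (by rw [h1, h0, zero_smul]))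
    refine ⟨(μ - Complex.I)⁻¹ • P k, X.smul_mem _ (Submodule.mem_sup_right
      (Submodule.subset_span ⟨k, rfl⟩)), ?_⟩
    rw [map_smul, h1, smul_smul, inv_mul_cancel₀ h2, one_smul]
  intro x hx
  have hmem : (T - Complex.I • 1) x ∈ X.map (T - Complex.I • 1) := by
    have huniv := (hPd.mono hspan).closure_eq
    rw [hclosed.closure_eq] at huniv
    have : (T - Complex.I • 1) x ∈ ((X.map (T - Complex.I • 1) : Submodule ℂ H) : Set H) := by
      rw [huniv]; trivial
    exact this
  obtain ⟨u, hu, hux⟩ := hmem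
  have : u - x = 0 := hL.isSymmOn.shift_inj hz (sub_mem (hXL hu) hx)
    (by rw [map_sub, hux, sub_self])
  rwa [← sub_eq_zero.mp this]

end Extension

/-! ### Translation to unbounded operators, and the GKN conditions. -/

section LinearPMap

variable {H : Type*} [NormedAddCommGroup H] [InnerProductSpace ℂ H]

theorem opPow_toPMap (T : Module.End ℂ H) (V : Submodule ℂ H) (n : ℕ) :
    opPow (LinearMap.toPMap T V) n = LinearMap.toPMap (T ^ n) (powDom T V n) := by
  induction n with
  | zero =>
    have : powDom T V 0 = ⊤ := eq_top_iff.mpr fun x _ => mem_powDom_zero x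
    rw [this]
    rfl
  | succ n ih =>
    rw [opPow, ih]
    refine LinearPMap.ext ?_ ?_
    · ext x
      rw [LinearMap.toPMap_domain, mem_powDom_succ']
      exact ⟨fun ⟨h, h'⟩ => ⟨h, h'⟩, fun ⟨h, h'⟩ => ⟨h, h'⟩⟩
    · intro x _ _
      change T ((T ^ n) x) = (T ^ (n + 1)) x
      rw [pow_succ', Module.End.mul_apply]

theorem opShift_toPMap (T : Module.End ℂ H) (V : Submodule ℂ H) (c : ℝ) :
    opShift (LinearMap.toPMap T V) c = LinearMap.toPMap (T - (-(c : ℂ)) • 1) V := by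
  refine LinearPMap.ext rfl ?_
  intro x _ _
  change (c : ℂ) • x + T x = (T - (-(c : ℂ)) • 1) x
  simp [add_comm]

theorem eq_toPMap_of_le {A : H →ₗ.[ℂ] H} {T : Module.End ℂ H} {W : Submodule ℂ H}
    (h : A ≤ LinearMap.toPMap T W) : A = LinearMap.toPMap T A.domain :=
  LinearPMap.ext rfl fun _ hx _ => h.2 (x := ⟨_, hx⟩) (y := ⟨_, h.1 hx⟩) rfl

theorem exists_eq_toPMap (A : H →ₗ.[ℂ] H) :
    ∃ T : Module.End ℂ H, A = LinearMap.toPMap T A.domain := by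
  obtain ⟨T, hT⟩ := LinearMap.exists_extend A.toFun
  exact ⟨T, LinearPMap.ext rfl fun x hx _ => (LinearMap.congr_fun hT ⟨x, hx⟩).symm⟩

theorem toPMap_mono (T : Module.End ℂ H) {V W : Submodule ℂ H} (h : V ≤ W) :
    LinearMap.toPMap T V ≤ LinearMap.toPMap T W :=
  ⟨h, fun _ _ hxy => congrArg T hxy⟩

theorem isClosed_toPMap_iff {T : Module.End ℂ H} {V : Submodule ℂ H} :
    (LinearMap.toPMap T V).IsClosed ↔ IsClosedOn T V := by
  have hg : ∀ p : H × H, p ∈ (LinearMap.toPMap T V).graph ↔ p.1 ∈ V ∧ T p.1 = p.2 := fun p => by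
    rw [LinearPMap.mem_graph_iff]
    constructor
    · rintro ⟨y, hy, hy'⟩
      rw [← hy, ← hy']
      exact ⟨y.2, rfl⟩
    · rintro ⟨h1, h2⟩
      exact ⟨⟨p.1, h1⟩, rfl, h2⟩
  rw [LinearPMap.IsClosed, ← isSeqClosed_iff_isClosed]
  constructor
  · intro h u x y hu hx hy
    exact (hg (x, y)).mp (h (x := fun k => (u k, T (u k))) (fun k => (hg _).mpr ⟨hu k, rfl⟩)
      (hx.prodMk_nhds hy))
  · intro h u p hu hp
    refine (hg p).mpr (h (fun k => (u k).1) _ _ (fun k => ((hg _).mp (hu k)).1)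
      ((continuous_fst.tendsto p).comp hp) ?_)
    refine ((continuous_snd.tendsto p).comp hp).congr fun k => ?_
    exact ((hg _).mp (hu k)).2.symm

variable [CompleteSpace H]

/-- The adjoint is single-valued: a `g` orthogonal to `V` is an admissible adjoint value at `0`,
hence equals `T 0 = 0`. -/
theorem IsAdjPair.dense {T : Module.End ℂ H} {V W : Submodule ℂ H} (h : IsAdjPair T V W) :
    Dense (V : Set H) := by
  rw [Submodule.dense_iff_topologicalClosure_eq_top, Submodule.topologicalClosure_eq_top_iff,
    eq_bot_iff]
  intro g hg
  have h1 := ((h 0 g).mp fun y hy => by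
    rw [inner_zero_left, (Submodule.mem_orthogonal' _ _).mp hg y hy]).2
  rw [← h1, map_zero]
  exact zero_mem _

theorem IsAdjPair.adjoint_eq {T : Module.End ℂ H} {V W : Submodule ℂ H} (h : IsAdjPair T V W) :
    (LinearMap.toPMap T V).adjoint = LinearMap.toPMap T W := by
  have hd : Dense ((LinearMap.toPMap T V).domain : Set H) := h.dense
  have hfa := LinearPMap.adjoint_isFormalAdjoint hd
  have key : ∀ x (hx : x ∈ (LinearMap.toPMap T V).adjoint.domain),
      x ∈ W ∧ T x = (LinearMap.toPMap T V).adjoint ⟨x, hx⟩ := fun x hx =>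
    (h x _).mp fun y hy => (hfa ⟨x, hx⟩ ⟨y, hy⟩).symm
  refine LinearPMap.ext (le_antisymm (fun x hx => (key x hx).1) fun x hx => ?_)
    fun x hx _ => (key x hx).2.symm
  exact LinearPMap.mem_adjoint_domain_of_exists x ⟨T x, fun y => h.inner_eq hx y.2⟩

theorem isAdjPair_of_adjoint_eq {T : Module.End ℂ H} {V W : Submodule ℂ H}
    (hd : Dense (V : Set H)) (h : (LinearMap.toPMap T V).adjoint = LinearMap.toPMap T W) :
    IsAdjPair T V W := by
  have hfa := LinearPMap.adjoint_isFormalAdjoint (T := LinearMap.toPMap T V) hd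
  rw [h] at hfa
  intro φ g
  constructor
  · intro hφ
    have hmem : φ ∈ (LinearMap.toPMap T V).adjoint.domain :=
      LinearPMap.mem_adjoint_domain_of_exists φ ⟨g, fun y => (hφ y y.2).symm⟩
    have hW : φ ∈ W := by rw [h] at hmem; exact hmem
    refine ⟨hW, hd.eq_of_inner_left ℂ fun y hy => ?_⟩
    rw [← hφ y hy]
    exact hfa ⟨φ, hW⟩ ⟨y, hy⟩
  · rintro ⟨hφ, rfl⟩ y hy
    exact (hfa ⟨φ, hφ⟩ ⟨y, hy⟩).symm

theorem defectSpace_toPMap {T : Module.End ℂ H} {V W : Submodule ℂ H} (h : IsAdjPair T V W)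
    (z : ℂ) : defectSpace (LinearMap.toPMap T V) z = eigDom T W z := by
  ext x
  change (∃ h : x ∈ (LinearMap.toPMap T V).adjoint.domain, _) ↔ _
  rw [h.adjoint_eq, mem_eigDom]
  exact ⟨fun ⟨h1, h2⟩ => ⟨h1, h2⟩, fun ⟨h1, h2⟩ => ⟨h1, h2⟩⟩

/-- Finitely many eigenvectors of a self-adjoint extension are GKN conditions for its domain. -/
theorem exists_isGKNConditions {T : Module.End ℂ H} {V L W : Submodule ℂ H}
    (h : IsAdjPair T V W) (hL : IsAdjPair T L L) (hVL : V ≤ L) (hc : IsClosedOn T V) {N : ℕ}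
    (hN : Module.rank ℂ (eigDom T W (-Complex.I)) = N)
    {P : ℕ → H} (hP0 : ∀ k, P k ≠ 0) (hPL : ∀ k, P k ∈ L) (hP : ∀ k, ∃ μ : ℂ, T (P k) = μ • P k)
    (hPd : Dense (Submodule.span ℂ (Set.range P) : Set H)) :
    ∃ κ : Fin N → ℕ, Function.Injective κ ∧
      IsGKNConditions (LinearMap.toPMap T V) L (fun i => P (κ i)) := by
  have hLW := h.le_of_le hL hVL
  have hrank := (rank_quotient_eq h hL hVL hc (z := Complex.I) (by simp)).1
  rw [Complex.conj_I, hN] at hrank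
  obtain ⟨κ, hκ, hli, hspan⟩ := exists_basis_modulo hVL hrank hPL
    (le_sup_span_eigenvectors h hL hVL hc hN hP0 hPL hP hPd)
  have hdom : (LinearMap.toPMap T V).adjoint.domain = W := by rw [h.adjoint_eq]; rfl
  have happ : ∀ x (hx : x ∈ (LinearMap.toPMap T V).adjoint.domain),
      (LinearMap.toPMap T V).adjoint ⟨x, hx⟩ = T x := by
    rw [h.adjoint_eq]; exact fun _ _ => rfl
  have hform : ∀ f g (hf : f ∈ (LinearMap.toPMap T V).adjoint.domain)
      (hg : g ∈ (LinearMap.toPMap T V).adjoint.domain),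
      boundaryForm (LinearMap.toPMap T V).adjoint ⟨f, hf⟩ ⟨g, hg⟩ =
        inner ℂ g (T f) - inner ℂ (T g) f := fun f g hf hg => by
    rw [boundaryForm, happ, happ]
  have hzero : ∀ f ∈ L, ∀ g ∈ L, inner ℂ g (T f) - inner ℂ (T g) f = 0 := fun f hf g hg => by
    rw [hL.inner_eq hg hf, sub_self]
  refine ⟨κ, hκ, fun i => hdom ▸ hLW (hPL _), hli,
    fun j k => (hform _ _ _ _).trans (hzero _ (hPL _) _ (hPL _)), fun f => ⟨fun hf =>
      ⟨hdom ▸ hLW hf, fun k => (hform _ _ _ _).trans (hzero _ hf _ (hPL _))⟩, ?_⟩⟩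
  rintro ⟨hf, hfk⟩
  have hfW : f ∈ W := hdom ▸ hf
  have hfk' : ∀ k, inner ℂ (P (κ k)) (T f) = inner ℂ (T (P (κ k))) f := fun k =>
    sub_eq_zero.mp ((hform _ _ _ _).symm.trans (hfk k))
  -- By self-adjointness it suffices to test `f` against `g ∈ L`. Modulo the eigenvectors, where
  -- `hfk'` applies, `g` lies in `V`, where the adjoint relation applies.
  refine ((hL f (T f)).mp fun g hg => ?_).1
  obtain ⟨c, hcg⟩ := hspan g hg
  have h1 := h.inner_eq hfW hcg
  have h2 : inner ℂ (T f) (∑ i, c i • P (κ i)) = inner ℂ f (T (∑ i, c i • P (κ i))) := by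
    simp only [map_sum, map_smul, inner_sum, inner_smul_right]
    refine Finset.sum_congr rfl fun i _ => ?_
    rw [← inner_conj_symm, hfk' i, inner_conj_symm]
  rw [map_sub, inner_sub_right, inner_sub_right, h2] at h1
  exact (sub_left_inj.mp h1).symm

end LinearPMap

end LeftDefinite

/-! ### Assembly for the minimal, self-adjoint and maximal operators. -/

theorem theorem5p2 {H : Type*} [NormedAddCommGroup H] [InnerProductSpace ℂ H] [CompleteSpace H]
    (Lmin L : H →ₗ.[ℂ] H) (m n : ℕ) (hn : 1 ≤ n)
    (hmin : LeftDefinite.IsClosedSymmetric Lmin)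
    (hdef : LeftDefinite.HasDeficiencyIndices Lmin m m)
    (hL : IsSelfAdjoint L) (hext : Lmin ≤ L)
    (hbdd : ∃ k : ℝ, LeftDefinite.IsBoundedBelowBy L k)
    (P : ℕ → H) (hP : LeftDefinite.IsCompleteOrthogonalEigensystem L P) :
    -- the `n`-th power of the minimal operator is again such a minimal operator, the associated
    -- maximal operator is the `n`-th power of the maximal one, and `L ^ n` is a self-adjoint
    -- extension
    (LeftDefinite.IsClosedSymmetric (LeftDefinite.opPow Lmin n) ∧
      (LeftDefinite.opPow Lmin n).adjoint = LeftDefinite.opPow Lmin.adjoint n ∧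
      IsSelfAdjoint (LeftDefinite.opPow L n) ∧
      LeftDefinite.opPow Lmin n ≤ LeftDefinite.opPow L n) ∧
    -- the deficiency indices
    LeftDefinite.HasDeficiencyIndices (LeftDefinite.opPow Lmin n) (n * m) (n * m) ∧
    -- the GKN conditions for `D(L ^ n)`, which is the `2n`-th left-definite space of `L`, for
    -- every admissible shift of `L`
    (∀ c k : ℝ, 0 < k → LeftDefinite.IsBoundedBelowBy (LeftDefinite.opShift L c) k →
      LeftDefinite.evenLeftDefiniteSpace (LeftDefinite.opShift L c) n =
        (LeftDefinite.opPow L n).domain) ∧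
    ∃ κ : Fin (n * m) → ℕ, Function.Injective κ ∧
      LeftDefinite.IsGKNConditions (LeftDefinite.opPow Lmin n) (LeftDefinite.opPow L n).domain
        (fun i => P (κ i)) := by
  have hd : Dense ((Lmin.domain : Submodule ℂ H) : Set H) := hmin.dense
  -- `T` is an arbitrary linear extension of the maximal operator to `H`. Its values off the maximal
  -- domain do not affect the powers, whose natural domains keep each iterate inside.
  obtain ⟨T, hT⟩ := LeftDefinite.exists_eq_toPMap Lmin.adjoint
  have hLd := hL.dense_domain
  have hLadj : L.adjoint = L := LinearPMap.isSelfAdjoint_def.mp hL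
  have hLfa : L.IsFormalAdjoint L := by
    have := LinearPMap.adjoint_isFormalAdjoint hLd
    rwa [hLadj] at this
  have hLM : L ≤ Lmin.adjoint := by
    refine LinearPMap.IsFormalAdjoint.le_adjoint hd fun x y => ?_
    rw [hext.2 (x := x) (y := ⟨x, hext.1 x.2⟩) rfl]
    exact hLfa _ y
  have hS' := hext.trans hLM
  rw [hT] at hLM hS'
  have hLT := LeftDefinite.eq_toPMap_of_le hLM
  have hST := LeftDefinite.eq_toPMap_of_le hS'
  generalize hVM : Lmin.adjoint.domain = M at hT hLM hS'
  generalize hVS : Lmin.domain = S at *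
  generalize hVL : L.domain = D at *
  subst hLT hST
  have hSD : S ≤ D := hext.1
  have hadj : LeftDefinite.IsAdjPair T S M := LeftDefinite.isAdjPair_of_adjoint_eq hd hT
  have hsa : LeftDefinite.IsAdjPair T D D := LeftDefinite.isAdjPair_of_adjoint_eq hLd hLadj
  have hcl : LeftDefinite.IsClosedOn T S := LeftDefinite.isClosed_toPMap_iff.mp hmin.closed
  have hsym : LeftDefinite.IsSymmOn T S := hsa.isSymmOn.mono hSD
  have hDM : D ≤ M := hLM.1
  have hm : Module.rank ℂ (LeftDefinite.eigDom T M Complex.I) = m := by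
    rw [← LeftDefinite.defectSpace_toPMap hadj]; exact hdef.1
  have hadjn : LeftDefinite.IsAdjPair (T ^ n) (LeftDefinite.powDom T S n)
      (LeftDefinite.powDom T M n) := by
    refine hadj.pow hsym hcl (fun z hz y => ?_) (fun z hz => ?_) hn
    · obtain ⟨x, hx, hxy⟩ := hsa.shift_surj hz y
      exact ⟨x, hDM hx, hxy⟩
    · refine Module.rank_lt_aleph0_iff.mp ?_
      rw [LeftDefinite.rank_eigDom_eq hsa hDM hz,
        ← LeftDefinite.rank_eigDom_eq hsa hDM (z := Complex.I) (by simp), hm]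
      exact Cardinal.natCast_lt_aleph0
  have hsan : LeftDefinite.IsAdjPair (T ^ n) (LeftDefinite.powDom T D n)
      (LeftDefinite.powDom T D n) := by
    refine hsa.pow hsa.isSymmOn hsa.isClosedOn (fun z hz => hsa.shift_surj hz) (fun z hz => ?_) hn
    have : LeftDefinite.eigDom T D z = ⊥ :=
      eq_bot_iff.mpr fun x hx => hsa.isSymmOn.shift_inj hz hx.1 hx.2
    rw [this]
    infer_instance
  have hle : LeftDefinite.powDom T S n ≤ LeftDefinite.powDom T D n :=
    LeftDefinite.powDom_mono hSD n
  have hcln := hsym.isClosedOn_pow hcl hn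
  have hrank : ∀ w : ℂ, w.im ≠ 0 → Module.rank ℂ (LeftDefinite.eigDom (T ^ n)
      (LeftDefinite.powDom T M n) w) = (n * m : ℕ) :=
    fun w hw => LeftDefinite.rank_eigDom_pow hsa hDM hm hn hw
  have heig : ∀ k, ∃ μ : ℂ, T (P k) = μ • P k := fun k => by
    obtain ⟨_, μ, hμ⟩ := hP.eigen k
    exact ⟨μ, hμ⟩
  have hpow : ∀ k (μ : ℂ), T (P k) = μ • P k → ∀ j, (T ^ j) (P k) = μ ^ j • P k :=
    fun k μ hμ j => by
      induction j with
      | zero => simp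
      | succ j ih => rw [pow_succ', Module.End.mul_apply, ih, map_smul, hμ, smul_smul, pow_succ]
  rw [hT]
  simp only [LeftDefinite.opPow_toPMap]
  refine ⟨⟨⟨hadjn.dense, fun x y => ?_, LeftDefinite.isClosed_toPMap_iff.mpr hcln⟩,
    hadjn.adjoint_eq, hsan.adjoint_eq, LeftDefinite.toPMap_mono _ hle⟩, ⟨?_, ?_⟩,
    fun c k _ _ => ?_, ?_⟩
  · exact hsan.isSymmOn x (hle x.2) y (hle y.2)
  · rw [LeftDefinite.defectSpace_toPMap hadjn]
    exact hrank _ (by simp)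
  · rw [LeftDefinite.defectSpace_toPMap hadjn]
    exact hrank _ (by simp)
  · rw [LeftDefinite.evenLeftDefiniteSpace, LeftDefinite.opShift_toPMap,
      LeftDefinite.opPow_toPMap]
    exact LeftDefinite.powDom_shift _ _
  -- The same `P k` serve for `T ^ n`, with eigenvalues `μ ^ n`.
  · refine LeftDefinite.exists_isGKNConditions hadjn hsan hle hcln (hrank _ (by simp)) hP.ne_zero
      (fun k j _ => ?_) (fun k => ?_) hP.complete
    · obtain ⟨μ, hμ⟩ := heig k
      rw [hpow k μ hμ]
      exact D.smul_mem _ (hP.eigen k).1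
    · obtain ⟨μ, hμ⟩ := heig k
      exact ⟨μ ^ n, hpow k μ hμ n⟩
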